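/- Let $\mathcal V$ be a finite vocabulary and let $X_1,X_2,\dots$ be $\mathcal V$-valued random variables on a probability space. A language model $p_\theta$ assigns a next-token distribution on $\mathcal V$ to every finite block of consecutive tokens (possibly depending on the position of the block). Write $p_t:=p_\theta(\cdot\mid X_{1:t-1})$, and let $X_{t-w:t-1}$ be the last $w$ tokens before step $t$ (all of $X_{1:t-1}$ if fewer than $w$ are available). Put $\mathrm{TV}(p,q)=\frac12\sum_{x\in\mathcal V}|p(x)-q(x)|$, and let $\mathrm{KL}(p\,\|\,q)\in[0,\infty]$ be the Kullback--Leibler divergence. Let $\mathcal M_{w,t}$ be the class of random distributions on $\mathcal V$ that are measurable with respect to $\sigma(X_{t-w:t-1})$. A *suffix-only policy with window $w\ge1$* is a sequence of reconstructions $q_t\in\mathcal M_{w,t}$, $t\ge1$; its window $w$ is its per-token cache memory (the number of retained tokens). Its average TV distortion is $\limsup_{n\to\infty}\frac1n\sum_{t=1}^n\mathbb E[\mathrm{TV}(p_t,q_t)]$, and its average KL distortion is $\limsup_{n\to\infty}\frac1n\sum_{t=1}^n\mathbb E[\mathrm{KL}(p_t\,\|\,q_t)]$. Let $\alpha,C,c>0$.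 The model has *$\alpha$-tight truncation sensitivity* with constants $C,c$ if (i) for all $t\ge1$ and $w\ge 1$, $\mathrm{TV}\bigl(p_t,\;p_\theta(\cdot\mid X_{t-w:t-1})\bigr)\le C\,w^{-\alpha}$ almost surely; and (ii) for every $w\ge1$, $$\liminf_{n\to\infty}\frac1n\sum_{t=1}^n\ \inf_{q\in\mathcal M_{w,t}}\mathbb E\bigl[\mathrm{TV}(p_t,q)\bigr]\ \ge\ c\,w^{-\alpha}.$$ **Corollary (memory characterization for suffix-only policies).** Assume $\alpha$-tight truncation sensitivity with constants $C,c$. 1. There are constants $a,b,\varepsilon_0>0$, depending only on $\alpha,C,c$, such that for every $\varepsilon\in(0,\varepsilon_0]$ there is a least window $w\ge1$ with which some suffix-only policy has average TV distortion at most $\varepsilon$, and it satisfies $a\,\varepsilon^{-1/\alpha}\le w\le b\,\varepsilon^{-1/\alpha}$. That is, the minimal window is $\Theta(\varepsilon^{-1/\alpha})$. 2. Assume in addition a bounded floor: for some $\delta>0$, for every $t$, almost surely $p_t(x)\ge\delta$ for all $x\in\mathcal V$. Then there are constants $a,b,\varepsilon_0>0$, depending only on $\alpha,C,c,\delta$,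 such that for every $\eta\in[0,\delta]$ and every $\varepsilon_{\mathrm{KL}}\in(0,\varepsilon_0]$ there is a least window $w\ge1$ with which some suffix-only policy satisfying the reconstruction floor $q_t(x)\ge\eta$ for all $t,x$ has average KL distortion at most $\varepsilon_{\mathrm{KL}}$, and it satisfies $a\,\varepsilon_{\mathrm{KL}}^{-1/(2\alpha)}\le w\le b\,\varepsilon_{\mathrm{KL}}^{-1/(2\alpha)}$. That is, the minimal window is $\Theta(\varepsilon_{\mathrm{KL}}^{-1/(2\alpha)})$, both over all suffix-only policies ($\eta=0$) and over those whose reconstructions obey the floor $\eta=\delta$. -/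

import Mathlib

open MeasureTheory Filter

open scoped ENNReal

universe u v

noncomputable section

/-- A language model over the vocabulary `V`. `p s l` is the next-token distribution
`p_θ(· | l)` that the model outputs when it is fed the list `l` of consecutive tokens, the first
of which sits at position `s` of the text. Dependence on `s` allows position-preserving truncation
(retained tokens keep their original indices); a model that re-indexes a truncated context as a
fresh sequence is the case in which `p s l` does not depend on `s`. -/
abbrev LanguageModel (V : Type*) := ℕ → List V → PMF V

/-- Total variation distance `½ ∑ₓ |p(x) - q(x)|` on a finite vocabulary. -/
def tvDist {V : Type*} [Fintype V] (p q : PMF V) : ℝ :=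
  (1 / 2) * ∑ x, |(p x).toReal - (q x).toReal|

section

variable {Ω V : Type*}

/-- The tokens with indices `s, s + 1, …, t - 1`. Tokens are indexed from `0`: the tokens that
precede step `t` are `X 0, …, X (t - 1)`. -/
def tokens (X : ℕ → Ω → V) (s t : ℕ) (ω : Ω) : List V :=
  (List.range' s (t - s)).map fun i => X i ω

/-- The next-token distribution of the model at step `t` given the full context. -/
def fullCond (p : LanguageModel V) (X : ℕ → Ω → V) (t : ℕ) (ω : Ω) : PMF V :=
  p 0 (tokens X 0 t ω)

/-- The next-token distribution of the model at step `t` given only the last `w` tokens of the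
context (the whole context if `t ≤ w`; note that `t - w` is then `0`). -/
def truncCond (p : LanguageModel V) (X : ℕ → Ω → V) (w t : ℕ) (ω : Ω) : PMF V :=
  p (t - w) (tokens X (t - w) t ω)

/-- The σ-algebra generated by the last `w` tokens before step `t`. -/
@[reducible] def suffixSigma [MeasurableSpace V] (X : ℕ → Ω → V) (w t : ℕ) : MeasurableSpace Ω :=
  ⨆ i ∈ Set.Ico (t - w) t, MeasurableSpace.comap (X i) inferInstance

/-- The class of suffix-only reconstructions at step `t`: random distributions on `V` that are
measurable with respect to the last `w` tokens. -/
def suffixClass [MeasurableSpace V] (X : ℕ → Ω → V) (w t : ℕ) : Set (Ω → PMF V) :=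
  {q | ∀ x, Measurable[suffixSigma X w t] fun ω => q ω x}

variable [Fintype V] [MeasurableSpace V] [MeasurableSpace Ω]

/-- Polynomial truncation sensitivity with exponent `α` and constant `C`. -/
def PolyTruncationSensitive (P : Measure Ω) (X : ℕ → Ω → V) (p : LanguageModel V)
    (α C : ℝ) : Prop :=
  ∀ t w : ℕ, 1 ≤ w → ∀ᵐ ω ∂P,
    tvDist (fullCond p X t ω) (truncCond p X w t ω) ≤ C * (w : ℝ) ^ (-α)

/-- The Bayes risk, in total variation, of approximating the full-context distribution at step `t`
by a reconstruction that is measurable with respect to the last `w` tokens. -/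
def bayesRisk (P : Measure Ω) (X : ℕ → Ω → V) (p : LanguageModel V) (w t : ℕ) : ℝ≥0∞ :=
  ⨅ q ∈ suffixClass X w t, ∫⁻ ω, ENNReal.ofReal (tvDist (fullCond p X t ω) (q ω)) ∂P

/-- Two-sided (tight) truncation sensitivity with exponent `α`, upper constant `C` and lower
constant `c`. -/
def TightTruncationSensitive (P : Measure Ω) (X : ℕ → Ω → V) (p : LanguageModel V)
    (α C c : ℝ) : Prop :=
  PolyTruncationSensitive P X p α C ∧
    ∀ w : ℕ, 1 ≤ w → ENNReal.ofReal (c * (w : ℝ) ^ (-α)) ≤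
      liminf (fun n : ℕ => (n : ℝ≥0∞)⁻¹ * ∑ t ∈ Finset.range n, bayesRisk P X p w t) atTop

/-- A suffix-only policy with window `w`: a reconstruction at every step, measurable with respect
to the last `w` tokens. -/
def IsSuffixOnlyPolicy (X : ℕ → Ω → V) (w : ℕ) (q : ℕ → Ω → PMF V) : Prop :=
  ∀ t, q t ∈ suffixClass X w t

/-- The long-run average expected total variation distortion of the reconstructions `q`. -/
def avgTV (P : Measure Ω) (X : ℕ → Ω → V) (p : LanguageModel V) (q : ℕ → Ω → PMF V) : ℝ≥0∞ :=
  limsup (fun n : ℕ => (n : ℝ≥0∞)⁻¹ * ∑ t ∈ Finset.range n,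
    ∫⁻ ω, ENNReal.ofReal (tvDist (fullCond p X t ω) (q t ω)) ∂P) atTop

/-- The long-run average expected Kullback–Leibler distortion of the reconstructions `q`. -/
def avgKL (P : Measure Ω) (X : ℕ → Ω → V) (p : LanguageModel V) (q : ℕ → Ω → PMF V) : ℝ≥0∞ :=
  limsup (fun n : ℕ => (n : ℝ≥0∞)⁻¹ * ∑ t ∈ Finset.range n,
    ∫⁻ ω, InformationTheory.klDiv (fullCond p X t ω).toMeasure (q t ω).toMeasure ∂P) atTop

/-- The windows (numbers of retained tokens) with which some suffix-only policy has average total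
variation distortion at most `ε`. -/
def feasibleTV (P : Measure Ω) (X : ℕ → Ω → V) (p : LanguageModel V) (ε : ℝ) : Set ℕ :=
  {w | 1 ≤ w ∧ ∃ q, IsSuffixOnlyPolicy X w q ∧ avgTV P X p q ≤ ENNReal.ofReal ε}

/-- The windows with which some suffix-only policy whose reconstructions put mass at least `η` on
every token has average Kullback–Leibler distortion at most `ε`. For `η = 0` the floor on the
reconstructions is no restriction. -/
def feasibleKL (P : Measure Ω) (X : ℕ → Ω → V) (p : LanguageModel V) (η ε : ℝ) : Set ℕ :=
  {w | 1 ≤ w ∧ ∃ q, IsSuffixOnlyPolicy X w q ∧ (∀ t ω x, ENNReal.ofReal η ≤ q t ω x) ∧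
    avgKL P X p q ≤ ENNReal.ofReal ε}

/-- Bounded floor: the next-token distributions of the model at evaluation put mass at least `δ`
on every token. -/
def HasFloor (P : Measure Ω) (X : ℕ → Ω → V) (p : LanguageModel V) (δ : ℝ) : Prop :=
  ∀ t, ∀ᵐ ω ∂P, ∀ x, ENNReal.ofReal δ ≤ fullCond p X t ω x

end

end

/-! Both parts trap the feasible windows between two power laws in `w`, which
`exists_isLeast_of_power_law` inverts; feasibility need not be monotone in `w`. For TV, the
truncated model is itself a policy with error at most `C * w ^ (-α)`, and the averaged Bayes risk
bounds every policy from below. For KL, distortion behaves like squared TV. Upper side: truncation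
may violate the floor, so `exists_policy_of_floor` replaces it by the full conditional of a typical
history with the same suffix, at twice the TV error; reverse Pinsker squares this. Lower side:
Pinsker, linearized as `TV ≤ s + KL / (4 * s)` so that it passes through expectations and time
averages, with `s = √ε`. -/

/-! ### Scalar bounds on `klFun`. -/

open InformationTheory in
lemma klFun_le_sq_sub_one {r : ℝ} (hr : 0 ≤ r) : klFun r ≤ (r - 1) ^ 2 := by
  rw [klFun_apply]
  rcases hr.eq_or_lt with rfl | hr
  · simp
  · nlinarith [mul_le_mul_of_nonneg_left (Real.log_le_sub_one_of_pos hr) hr.le]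

open InformationTheory in
-- Pointwise form of Hellinger ≤ KL, from `log √r ≥ 1 - 1 / √r`.
lemma sq_sqrt_sub_one_le_klFun {r : ℝ} (hr : 0 ≤ r) : (√r - 1) ^ 2 ≤ klFun r := by
  rw [klFun_apply]
  rcases hr.eq_or_lt with rfl | hr
  · simp
  · have hs : 0 < √r := Real.sqrt_pos.2 hr
    have hsq : √r * √r = r := Real.mul_self_sqrt hr.le
    have hlog : Real.log r = 2 * Real.log √r := by
      rw [Real.log_sqrt hr.le]; ring
    have h := mul_le_mul_of_nonneg_left (Real.one_sub_inv_le_log_of_pos hs) hr.le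
    have h2 : r * (1 - (√r)⁻¹) = r - √r := by
      rw [mul_sub, mul_one, ← div_eq_mul_inv, Real.div_sqrt]
    rw [hlog]
    nlinarith

open InformationTheory in
-- Weighted AM-GM on `|r - 1| = |√r - 1| * (√r + 1)`. The second term averages to `s`, because `r`
-- has mean one.
lemma abs_sub_one_le_klFun {r s : ℝ} (hr : 0 ≤ r) (hs : 0 < s) :
    (1 / 2) * |r - 1| ≤ klFun r / (4 * s) + s * ((r + 1) / 2) := by
  have hsq : √r * √r = r := Real.mul_self_sqrt hr
  have hr0 := Real.sqrt_nonneg r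
  have habs : |r - 1| = |√r - 1| * (√r + 1) := by
    rw [← abs_of_nonneg (a := √r + 1) (by positivity), ← abs_mul]
    congr 1
    linear_combination -hsq
  have h1 : (√r - 1) ^ 2 / (4 * s) ≤ klFun r / (4 * s) := by
    gcongr
    exact sq_sqrt_sub_one_le_klFun hr
  have h2 : s * ((√r + 1) ^ 2 / 4) ≤ s * ((r + 1) / 2) := by
    refine mul_le_mul_of_nonneg_left ?_ hs.le
    nlinarith [sq_nonneg (√r - 1)]
  have h3 : (1 / 2) * |r - 1| ≤ (√r - 1) ^ 2 / (4 * s) + s * ((√r + 1) ^ 2 / 4) := by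
    rw [habs, ← sq_abs (√r - 1), ← sub_nonneg]
    have : |√r - 1| ^ 2 / (4 * s) + s * ((√r + 1) ^ 2 / 4) - 1 / 2 * (|√r - 1| * (√r + 1))
        = (|√r - 1| - s * (√r + 1)) ^ 2 / (4 * s) := by
      field_simp
      ring
    rw [this]
    positivity
  linarith

/-! ### Pinsker and reverse Pinsker inequalities. -/

namespace PMF

variable {V : Type*} [Fintype V]

lemma sum_toReal (p : PMF V) : ∑ x, (p x).toReal = 1 := by
  rw [← ENNReal.toReal_sum fun x _ => p.apply_ne_top x, ← tsum_fintype (L := .unconditional _),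
    p.tsum_coe, ENNReal.toReal_one]

variable [MeasurableSpace V] [DiscreteMeasurableSpace V]

open InformationTheory in
/-- On a finite space the Kullback–Leibler divergence is a finite sum over the density. -/
lemma exists_klDiv_eq_sum {p q : PMF V} (h : p.toMeasure ≪ q.toMeasure) :
    ∃ r : V → ℝ, (∀ x, 0 ≤ r x) ∧ (∀ x, (q x).toReal * r x = (p x).toReal) ∧
      klDiv p.toMeasure q.toMeasure = ENNReal.ofReal (∑ x, (q x).toReal * klFun (r x)) := by
  refine ⟨fun x => (p.toMeasure.rnDeriv q.toMeasure x).toReal, fun x => ENNReal.toReal_nonneg,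
    fun x => ?_, ?_⟩
  · have h1 := Measure.setLIntegral_rnDeriv h {x}
    rw [lintegral_singleton, toMeasure_apply_singleton _ _ (measurableSet_singleton x),
      toMeasure_apply_singleton _ _ (measurableSet_singleton x)] at h1
    rw [← h1, ENNReal.toReal_mul, mul_comm]
  · rw [klDiv_eq_lintegral_klFun_of_ac h, lintegral_fintype,
      ENNReal.ofReal_sum_of_nonneg fun x _ =>
        mul_nonneg ENNReal.toReal_nonneg (klFun_nonneg ENNReal.toReal_nonneg)]
    refine Finset.sum_congr rfl fun x _ => ?_
    rw [toMeasure_apply_singleton _ _ (measurableSet_singleton x),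
      ENNReal.ofReal_mul ENNReal.toReal_nonneg, ENNReal.ofReal_toReal (q.apply_ne_top x), mul_comm]

open InformationTheory in
/-- Reverse Pinsker inequality: under a floor on the second argument the Kullback–Leibler
divergence is bounded by the squared total variation distance. -/
lemma klDiv_le_of_floor {p q : PMF V} {δ : ℝ} (hδ : 0 < δ)
    (hq : ∀ x, ENNReal.ofReal δ ≤ q x) :
    klDiv p.toMeasure q.toMeasure ≤ ENNReal.ofReal (4 / δ * tvDist p q ^ 2) := by
  have hq' : ∀ x, δ ≤ (q x).toReal := fun x => by
    rw [← ENNReal.ofReal_le_iff_le_toReal (q.apply_ne_top x)]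
    exact hq x
  have hac : p.toMeasure ≪ q.toMeasure := by
    intro s hs
    rw [toMeasure_apply_eq_zero_iff _ (MeasurableSet.of_discrete)] at hs
    have : s = ∅ := by
      refine Set.eq_empty_of_forall_notMem fun x hx => Set.disjoint_left.1 hs ?_ hx
      rw [mem_support_iff]
      exact ((ENNReal.ofReal_pos.2 hδ).trans_le (hq x)).ne'
    simp [this]
  obtain ⟨r, hr0, hr, hkl⟩ := exists_klDiv_eq_sum hac
  rw [hkl]
  refine ENNReal.ofReal_le_ofReal ?_
  calc ∑ x, (q x).toReal * klFun (r x)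
      ≤ ∑ x, |(p x).toReal - (q x).toReal| ^ 2 / δ := by
        refine Finset.sum_le_sum fun x _ => ?_
        have hqx : 0 < (q x).toReal := hδ.trans_le (hq' x)
        rw [sq_abs, ← hr x]
        calc (q x).toReal * klFun (r x) ≤ (q x).toReal * (r x - 1) ^ 2 := by
              gcongr; exact klFun_le_sq_sub_one (hr0 x)
          _ = ((q x).toReal * r x - (q x).toReal) ^ 2 / (q x).toReal := by
              field_simp
          _ ≤ _ := by gcongr; exact hq' x
    _ = (∑ x, |(p x).toReal - (q x).toReal| ^ 2) / δ := by rw [Finset.sum_div]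
    _ ≤ (∑ x, |(p x).toReal - (q x).toReal|) ^ 2 / δ := by
        gcongr
        exact Finset.sum_sq_le_sq_sum_of_nonneg fun x _ => abs_nonneg _
    _ = 4 / δ * tvDist p q ^ 2 := by rw [tvDist]; ring

open InformationTheory in
/-- A linearized form of Pinsker's inequality (with a non-optimal constant). -/
lemma tvDist_le_klDiv (p q : PMF V) {s : ℝ} (hs : 0 < s) :
    ENNReal.ofReal (tvDist p q) ≤
      ENNReal.ofReal s + ENNReal.ofReal (1 / (4 * s)) * klDiv p.toMeasure q.toMeasure := by
  by_cases hac : p.toMeasure ≪ q.toMeasure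
  · obtain ⟨r, hr0, hr, hkl⟩ := exists_klDiv_eq_sum hac
    rw [hkl, ← ENNReal.ofReal_mul (by positivity), ← ENNReal.ofReal_add hs.le
      (mul_nonneg (by positivity) (Finset.sum_nonneg fun x _ =>
        mul_nonneg ENNReal.toReal_nonneg (klFun_nonneg (hr0 x))))]
    refine ENNReal.ofReal_le_ofReal ?_
    calc tvDist p q = ∑ x, (q x).toReal * ((1 / 2) * |r x - 1|) := by
          rw [tvDist, Finset.mul_sum]
          refine Finset.sum_congr rfl fun x _ => ?_
          have : (p x).toReal - (q x).toReal = (q x).toReal * (r x - 1) := by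
            rw [← hr x]; ring
          rw [this, abs_mul, abs_of_nonneg ENNReal.toReal_nonneg]
          ring
      _ ≤ ∑ x, (q x).toReal * (klFun (r x) / (4 * s) + s * ((r x + 1) / 2)) := by
          gcongr with x
          exact abs_sub_one_le_klFun (hr0 x) hs
      _ = ∑ x, (1 / (4 * s) * ((q x).toReal * klFun (r x)) + s / 2 * (p x).toReal
            + s / 2 * (q x).toReal) := by
          refine Finset.sum_congr rfl fun x _ => ?_
          rw [← hr x]; ring
      _ = s + 1 / (4 * s) * ∑ x, (q x).toReal * klFun (r x) := by
          rw [Finset.sum_add_distrib, Finset.sum_add_distrib, ← Finset.mul_sum, ← Finset.mul_sum,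
            ← Finset.mul_sum, sum_toReal, sum_toReal]
          ring
  -- Without absolute continuity the right-hand side is infinite.
  · rw [klDiv_of_not_ac hac, ENNReal.mul_top (ENNReal.ofReal_pos.2 (by positivity)).ne', add_top]
    exact le_top

end PMF

section tvDist

variable {V : Type*} [Fintype V]

lemma tvDist_nonneg (p q : PMF V) : 0 ≤ tvDist p q := by
  unfold tvDist; positivity

lemma tvDist_comm (p q : PMF V) : tvDist p q = tvDist q p := by
  simp only [tvDist, abs_sub_comm]

lemma tvDist_triangle (p q r : PMF V) : tvDist p r ≤ tvDist p q + tvDist q r := by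
  unfold tvDist
  rw [← mul_add, ← Finset.sum_add_distrib]
  gcongr
  exact abs_sub_le _ _ _

end tvDist

/-! ### Inverting power laws. -/

/-- A set of windows squeezed between two power laws has a least element of the order
prescribed by the power law. -/
lemma exists_isLeast_of_power_law {F : Set ℕ} {K k β ε : ℝ} (hK : 0 < K) (hk : 0 < k)
    (hβ : 0 < β) (hε : 0 < ε) (hεK : ε ≤ K)
    (hmem : ∀ w : ℕ, 1 ≤ w → K * (w : ℝ) ^ (-β) ≤ ε → w ∈ F)
    (hF : ∀ w ∈ F, 1 ≤ w ∧ k * (w : ℝ) ^ (-β) ≤ ε) :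
    ∃ w : ℕ, IsLeast F w ∧ k ^ (1 / β) * ε ^ (-(1 / β)) ≤ (w : ℝ) ∧
      (w : ℝ) ≤ 2 * K ^ (1 / β) * ε ^ (-(1 / β)) := by
  have hpow : ∀ z : ℝ, 0 < z → z ^ (1 / β) * ε ^ (-(1 / β)) = (z / ε) ^ (1 / β) := fun z hz => by
    rw [Real.div_rpow hz.le hε.le, Real.rpow_neg hε.le]
    exact (div_eq_mul_inv _ _).symm
  have hiff : ∀ z : ℝ, 0 < z → ∀ w : ℕ, 1 ≤ w →
      (z * (w : ℝ) ^ (-β) ≤ ε ↔ (z / ε) ^ (1 / β) ≤ w) := fun z hz w hw => by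
    have hw' : (0 : ℝ) < w := by exact_mod_cast hw
    rw [one_div, Real.rpow_inv_le_iff_of_pos (by positivity) hw'.le hβ, Real.rpow_neg hw'.le,
      ← div_eq_mul_inv, div_le_iff₀ (by positivity), div_le_iff₀ hε, mul_comm]
  set y := (K / ε) ^ (1 / β) with hy
  -- `ε ≤ K` gives `y ≥ 1`, so `⌈y⌉₊ ≤ y + 1 ≤ 2 * y`: hence the factor 2.
  have hy1 : 1 ≤ y := Real.one_le_rpow ((one_le_div hε).2 hεK) (by positivity)
  have hw1 : 1 ≤ ⌈y⌉₊ := Nat.one_le_ceil_iff.2 (by linarith)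
  have hwF : ⌈y⌉₊ ∈ F := hmem _ hw1 ((hiff K hK _ hw1).2 (Nat.le_ceil y))
  classical
  have hne : ∃ w, w ∈ F := ⟨_, hwF⟩
  refine ⟨Nat.find hne, ⟨Nat.find_spec hne, fun w hw => Nat.find_min' hne hw⟩, ?_, ?_⟩
  · obtain ⟨h1, h2⟩ := hF _ (Nat.find_spec hne)
    rw [hpow k hk]
    exact (hiff k hk _ h1).1 h2
  · rw [mul_assoc, hpow K hK, ← hy]
    have h1 : (Nat.find hne : ℝ) ≤ ⌈y⌉₊ := by exact_mod_cast Nat.find_min' hne hwF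
    have h2 := Nat.ceil_lt_add_one (a := y) (by linarith)
    linarith

/-! ### Time averages. -/

section average

lemma average_le_of_le {f : ℕ → ℝ≥0∞} {K : ℝ≥0∞} (h : ∀ t, f t ≤ K) (n : ℕ) :
    (n : ℝ≥0∞)⁻¹ * ∑ t ∈ Finset.range n, f t ≤ K := by
  calc (n : ℝ≥0∞)⁻¹ * ∑ t ∈ Finset.range n, f t
      ≤ (n : ℝ≥0∞)⁻¹ * (n * K) := by
        gcongr
        simpa using Finset.sum_le_card_nsmul (Finset.range n) f K fun t _ => h t
    _ = (n : ℝ≥0∞)⁻¹ * n * K := (mul_assoc _ _ _).symm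
    -- Only an inequality: at `n = 0` the product `⊤ * 0` is `0`.
    _ ≤ 1 * K := by gcongr; exact ENNReal.inv_mul_le_one _
    _ = K := one_mul K

lemma average_le_add_mul {f g : ℕ → ℝ≥0∞} {a k : ℝ≥0∞} (h : ∀ t, f t ≤ a + k * g t) (n : ℕ) :
    (n : ℝ≥0∞)⁻¹ * ∑ t ∈ Finset.range n, f t ≤
      a + k * ((n : ℝ≥0∞)⁻¹ * ∑ t ∈ Finset.range n, g t) := by
  calc (n : ℝ≥0∞)⁻¹ * ∑ t ∈ Finset.range n, f t
      ≤ (n : ℝ≥0∞)⁻¹ * ∑ t ∈ Finset.range n, (a + k * g t) := by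
        gcongr with t; exact h t
    _ = (n : ℝ≥0∞)⁻¹ * ∑ t ∈ Finset.range n, a + k * ((n : ℝ≥0∞)⁻¹ * ∑ t ∈ Finset.range n, g t) := by
        rw [Finset.sum_add_distrib, ← Finset.mul_sum]; ring
    _ ≤ _ := by gcongr; exact average_le_of_le (fun _ => le_rfl) n

lemma limsup_average_le {f : ℕ → ℝ≥0∞} {K : ℝ≥0∞} (h : ∀ t, f t ≤ K) :
    limsup (fun n : ℕ => (n : ℝ≥0∞)⁻¹ * ∑ t ∈ Finset.range n, f t) atTop ≤ K :=
  limsup_le_of_le (by isBoundedDefault) (Eventually.of_forall (average_le_of_le h))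

end average

/-! ### Measurability with respect to the suffix. -/

section tokens

variable {Ω V : Type*} [MeasurableSpace V] [DiscreteMeasurableSpace V]

/-- There are countably many lists, so every preimage is a countable union of cylinders and `g` may
be arbitrary. -/
lemma measurable_comp_list_map [Countable V] [MeasurableSpace Ω] {β : Type*} [MeasurableSpace β]
    {X : ℕ → Ω → V} {L : List ℕ} (hX : ∀ i ∈ L, Measurable (X i)) (g : List V → β) :
    Measurable fun ω => g (L.map fun i => X i ω) := by
  have key : ∀ l : List V, MeasurableSet {ω | (L.map fun i => X i ω) = l} := by
    induction L with
    | nil => intro l; simp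
    | cons a L ih =>
      rintro (_ | ⟨v, l⟩)
      · simp
      · simp only [List.map_cons, List.cons.injEq]
        exact ((hX a (by simp)) (measurableSet_singleton v)).inter
          (ih (fun i hi => hX i (by simp [hi])) l)
  intro s _
  have : (fun ω => g (L.map fun i => X i ω)) ⁻¹' s =
      ⋃ l ∈ g ⁻¹' s, {ω | (L.map fun i => X i ω) = l} := by
    ext ω; simp
  rw [this]
  exact MeasurableSet.biUnion (Set.to_countable _) fun l _ => key l

lemma measurable_comp_tokens [Countable V] (X : ℕ → Ω → V) (w t : ℕ) {β : Type*}
    [MeasurableSpace β] (g : List V → β) :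
    Measurable[suffixSigma X w t] fun ω => g (tokens X (t - w) t ω) := by
  let _ := suffixSigma X w t
  refine measurable_comp_list_map (fun i hi => ?_) g
  rw [List.mem_range'_1] at hi
  have hi' : i ∈ Set.Ico (t - w) t := ⟨hi.1, by omega⟩
  exact Measurable.of_comap_le (le_iSup₂_of_le i hi' le_rfl)

lemma isSuffixOnlyPolicy_truncCond [Fintype V] (X : ℕ → Ω → V)
    (p : LanguageModel V) (w : ℕ) : IsSuffixOnlyPolicy X w (truncCond p X w) :=
  fun t x => measurable_comp_tokens X w t fun l => p (t - w) l x

end tokens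

lemma avgTV_truncCond_le {Ω V : Type*} [Fintype V] [MeasurableSpace Ω] {P : Measure Ω}
    [IsProbabilityMeasure P] {X : ℕ → Ω → V} {p : LanguageModel V} {α C : ℝ} {w : ℕ}
    (h : PolyTruncationSensitive P X p α C)
    (hw : 1 ≤ w) : avgTV P X p (truncCond p X w) ≤ ENNReal.ofReal (C * (w : ℝ) ^ (-α)) := by
  refine limsup_average_le fun t => ?_
  calc _ ≤ ∫⁻ _, ENNReal.ofReal (C * (w : ℝ) ^ (-α)) ∂P :=
        lintegral_mono_ae ((h t w hw).mono fun ω hω => ENNReal.ofReal_le_ofReal hω)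
    _ = _ := by simp

/-! ### Upper and lower bounds for policies. -/

section policies

variable {Ω V : Type*} [Fintype V] [MeasurableSpace V] [MeasurableSpace Ω] {P : Measure Ω}
  {X : ℕ → Ω → V} {p : LanguageModel V} {α C c δ : ℝ} {w : ℕ}

/-- Under a floor on the full-context distributions, the suffix determines, up to the truncation
error, a reconstruction which obeys the same floor: the full-context distribution of a
representative history with that suffix. -/
lemma exists_policy_of_floor [DiscreteMeasurableSpace V] [IsProbabilityMeasure P]
    (h : PolyTruncationSensitive P X p α C) (hδ : HasFloor P X p δ) (hw : 1 ≤ w) :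
    ∃ q, IsSuffixOnlyPolicy X w q ∧ (∀ t ω x, ENNReal.ofReal δ ≤ q t ω x) ∧
      ∀ t, ∀ᵐ ω ∂P, tvDist (fullCond p X t ω) (q t ω) ≤ 2 * (C * (w : ℝ) ^ (-α)) := by
  classical
  set B := C * (w : ℝ) ^ (-α)
  let good : ℕ → Ω → Prop := fun t ω => (∀ x, ENNReal.ofReal δ ≤ fullCond p X t ω x) ∧
    tvDist (fullCond p X t ω) (truncCond p X w t ω) ≤ B
  have hgood : ∀ t, ∀ᵐ ω ∂P, good t ω := fun t => (hδ t).and (h t w hw)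
  have hrep : ∀ t, ∃ g : List V → Ω, ∀ l, good t (g l) ∧
      ∀ ω, good t ω → tokens X (t - w) t ω = l → tokens X (t - w) t (g l) = l := fun t => by
    obtain ⟨ω₀, h₀⟩ := (hgood t).exists
    choose g hg using fun l : List V => show ∃ ω', good t ω' ∧
        ∀ ω, good t ω → tokens X (t - w) t ω = l → tokens X (t - w) t ω' = l by
      by_cases hl : ∃ ω, good t ω ∧ tokens X (t - w) t ω = l
      · obtain ⟨ω, h1, h2⟩ := hl
        exact ⟨ω, h1, fun _ _ _ => h2⟩
      -- Suffixes of no good history get a fixed good default, so that the floor holds at every `ω`.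
      · exact ⟨ω₀, h₀, fun ω h1 h2 => (hl ⟨ω, h1, h2⟩).elim⟩
    exact ⟨g, hg⟩
  choose g hg using hrep
  refine ⟨fun t ω => fullCond p X t (g t (tokens X (t - w) t ω)),
    fun t x => measurable_comp_tokens X w t fun l => fullCond p X t (g t l) x,
    fun t ω x => (hg t _).1.1 x, fun t => (hgood t).mono fun ω hω => ?_⟩
  have h1 := (hg t (tokens X (t - w) t ω)).1.2
  -- Both histories share this truncation, so passing through it costs `B` twice.
  have h2 : truncCond p X w t (g t (tokens X (t - w) t ω)) = truncCond p X w t ω := by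
    rw [truncCond, truncCond, (hg t _).2 ω hω rfl]
  rw [h2, tvDist_comm] at h1
  linarith [tvDist_triangle (fullCond p X t ω) (truncCond p X w t ω)
    (fullCond p X t (g t (tokens X (t - w) t ω))), hω.2]

lemma avgKL_le_of_tvDist_le [DiscreteMeasurableSpace V] [IsProbabilityMeasure P]
    {q : ℕ → Ω → PMF V} {B : ℝ} (hδ : 0 < δ) (hq : ∀ t ω x, ENNReal.ofReal δ ≤ q t ω x)
    (hB : ∀ t, ∀ᵐ ω ∂P, tvDist (fullCond p X t ω) (q t ω) ≤ B) :
    avgKL P X p q ≤ ENNReal.ofReal (4 / δ * B ^ 2) := by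
  refine limsup_average_le fun t => ?_
  calc _ ≤ ∫⁻ _, ENNReal.ofReal (4 / δ * B ^ 2) ∂P := by
        refine lintegral_mono_ae ((hB t).mono fun ω hω => ?_)
        refine (PMF.klDiv_le_of_floor hδ (hq t ω)).trans (ENNReal.ofReal_le_ofReal ?_)
        have := tvDist_nonneg (fullCond p X t ω) (q t ω)
        gcongr
    _ = _ := by simp

lemma bayesRisk_le {q : ℕ → Ω → PMF V} (hq : IsSuffixOnlyPolicy X w q) (t : ℕ) :
    bayesRisk P X p w t ≤ ∫⁻ ω, ENNReal.ofReal (tvDist (fullCond p X t ω) (q t ω)) ∂P :=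
  iInf₂_le (q t) (hq t)

lemma TightTruncationSensitive.le_avgTV (h : TightTruncationSensitive P X p α C c) (hw : 1 ≤ w)
    {q : ℕ → Ω → PMF V} (hq : IsSuffixOnlyPolicy X w q) :
    ENNReal.ofReal (c * (w : ℝ) ^ (-α)) ≤ avgTV P X p q := by
  refine (h.2 w hw).trans (le_trans ?_ liminf_le_limsup)
  refine liminf_le_liminf (Eventually.of_forall fun n => ?_)
  gcongr with t
  exact bayesRisk_le hq t

lemma TightTruncationSensitive.le_sqrt_of_avgKL_le [DiscreteMeasurableSpace V]
    [IsProbabilityMeasure P] (h : TightTruncationSensitive P X p α C c) (hw : 1 ≤ w)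
    {q : ℕ → Ω → PMF V} (hq : IsSuffixOnlyPolicy X w q) {ε : ℝ} (hε : 0 < ε)
    (hKL : avgKL P X p q ≤ ENNReal.ofReal ε) : c * (w : ℝ) ^ (-α) ≤ 2 * √ε := by
  have hs : 0 < √ε := Real.sqrt_pos.2 hε
  -- The strict slack makes the time averages eventually smaller than `2 * ε`; then `√ε + √ε / 2 ≤ 2
  -- * √ε`.
  have hlt : avgKL P X p q < ENNReal.ofReal (2 * ε) :=
    hKL.trans_lt ((ENNReal.ofReal_lt_ofReal_iff (by positivity)).2 (by linarith))
  have hstep : ∀ t, bayesRisk P X p w t ≤ ENNReal.ofReal √ε + ENNReal.ofReal (1 / (4 * √ε)) *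
      ∫⁻ ω, InformationTheory.klDiv (fullCond p X t ω).toMeasure (q t ω).toMeasure ∂P := fun t =>
    calc _ ≤ _ := bayesRisk_le hq t
      _ ≤ ∫⁻ ω, (ENNReal.ofReal √ε + ENNReal.ofReal (1 / (4 * √ε)) *
          InformationTheory.klDiv (fullCond p X t ω).toMeasure (q t ω).toMeasure) ∂P :=
        lintegral_mono fun ω => PMF.tvDist_le_klDiv _ _ hs
      _ = _ := by
        -- These forms need no measurability of the divergence.
        rw [lintegral_add_left measurable_const, lintegral_const_mul' _ _ ENNReal.ofReal_ne_top]
        simp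
  have hle : ENNReal.ofReal (c * (w : ℝ) ^ (-α)) ≤ ENNReal.ofReal (2 * √ε) := by
    refine (h.2 w hw).trans (liminf_le_of_frequently_le' (Eventually.frequently ?_))
    filter_upwards [eventually_lt_of_limsup_lt hlt] with n hn
    calc _ ≤ _ := average_le_add_mul hstep n
      _ ≤ ENNReal.ofReal √ε + ENNReal.ofReal (1 / (4 * √ε)) * ENNReal.ofReal (2 * ε) := by
        gcongr
      _ = ENNReal.ofReal (√ε + 1 / (4 * √ε) * (2 * ε)) := by
        rw [← ENNReal.ofReal_mul (by positivity), ← ENNReal.ofReal_add hs.le (by positivity)]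
      _ ≤ _ := by
        refine ENNReal.ofReal_le_ofReal ?_
        have : 1 / (4 * √ε) * (2 * ε) = √ε / 2 := by
          nth_rewrite 2 [← Real.mul_self_sqrt hε.le]
          field_simp
          norm_num
        linarith
  exact (ENNReal.ofReal_le_ofReal_iff (by positivity)).1 hle

end policies

/-! ### The two characterizations. -/

theorem mainTheorem1 (α C c : ℝ) (hα : 0 < α) (hC : 0 < C) (hc : 0 < c) :
    (∃ a b ε₀ : ℝ, 0 < a ∧ 0 < b ∧ 0 < ε₀ ∧
      ∀ (Ω : Type u) [MeasurableSpace Ω] (P : Measure Ω) [IsProbabilityMeasure P]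
        (V : Type v) [Fintype V] [MeasurableSpace V] [DiscreteMeasurableSpace V]
        (X : ℕ → Ω → V) (p : LanguageModel V),
        (∀ i, Measurable (X i)) → TightTruncationSensitive P X p α C c →
        ∀ ε : ℝ, 0 < ε → ε ≤ ε₀ →
          ∃ w : ℕ, IsLeast (feasibleTV P X p ε) w ∧
            a * ε ^ (-(1 / α)) ≤ (w : ℝ) ∧ (w : ℝ) ≤ b * ε ^ (-(1 / α))) ∧
    (∀ δ : ℝ, 0 < δ → ∃ a b ε₀ : ℝ, 0 < a ∧ 0 < b ∧ 0 < ε₀ ∧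
      ∀ (Ω : Type u) [MeasurableSpace Ω] (P : Measure Ω) [IsProbabilityMeasure P]
        (V : Type v) [Fintype V] [MeasurableSpace V] [DiscreteMeasurableSpace V]
        (X : ℕ → Ω → V) (p : LanguageModel V),
        (∀ i, Measurable (X i)) → TightTruncationSensitive P X p α C c → HasFloor P X p δ →
        ∀ η : ℝ, 0 ≤ η → η ≤ δ → ∀ ε : ℝ, 0 < ε → ε ≤ ε₀ →
          ∃ w : ℕ, IsLeast (feasibleKL P X p η ε) w ∧
            a * ε ^ (-(1 / (2 * α))) ≤ (w : ℝ) ∧ (w : ℝ) ≤ b * ε ^ (-(1 / (2 * α)))) := by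
  have hsq : ∀ (z : ℝ) (w : ℕ), (z * (w : ℝ) ^ (-α)) ^ 2 = z ^ 2 * (w : ℝ) ^ (-(2 * α)) :=
    fun z w => by
      rw [mul_pow, ← Real.rpow_natCast ((w : ℝ) ^ (-α)) 2, ← Real.rpow_mul (Nat.cast_nonneg w)]
      congr 2
      push_cast
      ring
  -- For KL, `16 * C ^ 2 / δ` is `4 / δ` times the square of the doubled error `2 * C`, and `(c / 2)
  -- ^ 2` comes from `c * w ^ (-α) ≤ 2 * √ε`.
  refine ⟨⟨c ^ (1 / α), 2 * C ^ (1 / α), C, by positivity, by positivity, hC, ?_⟩,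
    fun δ hδ => ⟨((c / 2) ^ 2) ^ (1 / (2 * α)), 2 * (16 * C ^ 2 / δ) ^ (1 / (2 * α)),
      16 * C ^ 2 / δ, by positivity, by positivity, by positivity, ?_⟩⟩
  · intro Ω _ P _ V _ _ _ X p _ h ε hε hεC
    refine exists_isLeast_of_power_law hC hc hα hε hεC (fun w hw hwε => ?_) ?_
    · exact ⟨hw, _, isSuffixOnlyPolicy_truncCond X p w,
        (avgTV_truncCond_le h.1 hw).trans (ENNReal.ofReal_le_ofReal hwε)⟩
    · rintro w ⟨hw, q, hq, hqε⟩
      exact ⟨hw, (ENNReal.ofReal_le_ofReal_iff hε.le).1 ((h.le_avgTV hw hq).trans hqε)⟩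
  · intro Ω _ P _ V _ _ _ X p _ h hfloor η _ hηδ ε hε hεK
    refine exists_isLeast_of_power_law (by positivity) (by positivity) (by positivity) hε hεK
      (fun w hw hwε => ?_) ?_
    · obtain ⟨q, hq, hqδ, hB⟩ := exists_policy_of_floor h.1 hfloor hw
      refine ⟨hw, q, hq, fun t ω x => (ENNReal.ofReal_le_ofReal hηδ).trans (hqδ t ω x),
        (avgKL_le_of_tvDist_le hδ hqδ hB).trans (ENNReal.ofReal_le_ofReal ?_)⟩
      rw [mul_pow, hsq]
      refine le_of_eq_of_le ?_ hwε
      ring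
    · rintro w ⟨hw, q, hq, -, hqε⟩
      refine ⟨hw, ?_⟩
      have h1 : c / 2 * (w : ℝ) ^ (-α) ≤ √ε := by
        linarith [h.le_sqrt_of_avgKL_le hw hq hε hqε]
      rw [← hsq, ← Real.sq_sqrt hε.le]
      gcongr
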